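/- Let $L$ be a countable first-order language and let $T$ be a complete $L$-theory which is small, i.e. for every $n\ge 1$ the space $S_n(T)$ of complete $n$-types over $T$ is countable. Let $M$ be a model of $T$ and let $G$ be a group definable in $M$ (with parameters): the underlying set of $G$ is a definable subset of some Cartesian power $M^k$, and the graph of the multiplication of $G$ is a definable subset of $M^{3k}$. Then $G$ is definably amenable. That is, there is a finitely additive probability measure $\mu$ on the Boolean algebra of all subsets of $G$ that are definable in $M$ with parameters from $M$ (a Keisler measure on $G$ over $M$) such that $\mu(gX)=\mu(X)$ for every $g\in G$ and every definable $X\subseteq G$. -/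

import Mathlib

open FirstOrder FirstOrder.Language Set

universe u v w

/-- A complete theory in a countable language is *small* if for all `n ≥ 1` the space `S_n(T)` of
complete `n`-types over `T` is countable. -/
structure FirstOrder.Language.Theory.IsSmall {L : FirstOrder.Language.{u, v}} (T : L.Theory) :
    Prop where
  countable_language : Countable L.Symbols
  isComplete : T.IsComplete
  countable_types : ∀ n : ℕ, 1 ≤ n → Countable (T.CompleteType (Fin n))

/-- A group definable, with parameters, in the `L`-structure `M`: a group whose underlying set is a
definable subset of some finite Cartesian power of `M` and whose multiplication has a definable
graph. -/
structure DefinableGroup (L : FirstOrder.Language.{u, v}) (M : Type w) [L.Structure M] where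
  /-- The ambient Cartesian power is `M ^ dim`. -/
  dim : ℕ
  /-- The underlying set of the group. -/
  carrier : Set (Fin dim → M)
  definable_carrier : (Set.univ : Set M).Definable L carrier
  /-- The group structure on the underlying set. -/
  group : Group carrier
  definable_mul : (Set.univ : Set M).Definable L
    {v : Fin dim ⊕ (Fin dim ⊕ Fin dim) → M |
      ∃ g h : carrier, v = Sum.elim g.1 (Sum.elim h.1 (g * h).1)}

namespace DefinableGroup

variable {L : FirstOrder.Language.{u, v}} {M : Type w} [L.Structure M]

instance instGroupCarrier (G : DefinableGroup L M) : Group G.carrier := G.group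

/-- The Boolean algebra of all subsets of `G` that are definable in `M` with parameters. -/
def definableSubsets (G : DefinableGroup L M) : BooleanSubalgebra (Set G.carrier) where
  carrier := {X | (Set.univ : Set M).Definable L (Subtype.val '' X)}
  supClosed' := by
    intro X hX Y hY
    have h := Set.Definable.union hX hY
    rwa [← Set.image_union] at h
  infClosed' := by
    intro X hX Y hY
    have h := Set.Definable.inter hX hY
    rwa [← Set.image_inter Subtype.val_injective] at h
  compl_mem' := by
    intro X hX
    have h := G.definable_carrier.sdiff hX
    have e : G.carrier \ Subtype.val '' X = Subtype.val '' Xᶜ := by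
      rw [Set.image_compl_eq_range_sdiff_image Subtype.val_injective, Subtype.range_coe]
    rwa [e] at h
  bot_mem' := by
    have e : (Subtype.val '' (⊥ : Set G.carrier) : Set (Fin G.dim → M)) = ∅ := by simp
    change (Set.univ : Set M).Definable L (Subtype.val '' (⊥ : Set G.carrier))
    rw [e]
    exact Set.definable_empty

theorem mem_definableSubsets {G : DefinableGroup L M} {X : Set G.carrier} :
    X ∈ G.definableSubsets ↔ (Set.univ : Set M).Definable L (Subtype.val '' X) :=
  Iff.rfl

/-- Left translates of definable subsets of a definable group are definable. -/
theorem image_mul_left_mem (G : DefinableGroup L M) (g : G.carrier) {X : Set G.carrier}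
    (hX : X ∈ G.definableSubsets) : (fun x => g * x) '' X ∈ G.definableSubsets := by
  rw [mem_definableSubsets] at hX ⊢
  have hg : (Set.univ : Set M).Definable L {v : Fin G.dim → M | v = g.1} := by
    have h : ∀ i : Fin G.dim, (Set.univ : Set M).Definable L {v : Fin G.dim → M | v i = g.1 i} := by
      intro i
      refine ⟨(Term.var i).equal (L.con (⟨g.1 i, trivial⟩ : (Set.univ : Set M))).term, ?_⟩
      ext v
      simp
    have h' := Set.definable_biInter_finset h Finset.univ
    have e : {v : Fin G.dim → M | v = g.1} =
        ⋂ i ∈ (Finset.univ : Finset (Fin G.dim)), {v : Fin G.dim → M | v i = g.1 i} := by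
      ext v
      simp [funext_iff]
    rwa [e]
  have h1 := hg.preimage_comp (Sum.inl : Fin G.dim → Fin G.dim ⊕ (Fin G.dim ⊕ Fin G.dim))
  have h2 := hX.preimage_comp
    (Sum.inr ∘ Sum.inl : Fin G.dim → Fin G.dim ⊕ (Fin G.dim ⊕ Fin G.dim))
  have h3 := ((G.definable_mul.inter h1).inter h2).image_comp
    (Sum.inr ∘ Sum.inr : Fin G.dim → Fin G.dim ⊕ (Fin G.dim ⊕ Fin G.dim))
  convert h3 using 1
  ext w
  constructor
  · rintro ⟨_, ⟨x, hx, rfl⟩, rfl⟩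
    exact ⟨Sum.elim g.1 (Sum.elim x.1 (g * x).1), ⟨⟨⟨g, x, rfl⟩, rfl⟩, ⟨x, hx, rfl⟩⟩, rfl⟩
  · rintro ⟨_, ⟨⟨⟨a, b, rfl⟩, ha⟩, ⟨x, hx, hb⟩⟩, rfl⟩
    have ha' : a = g := Subtype.ext ha
    have hb' : x = b := Subtype.ext hb
    subst ha' hb'
    exact ⟨a * x, ⟨x, hx, rfl⟩, rfl⟩

/-- The left translate `g X` of a definable subset `X` of `G`, as a definable subset of `G`. -/
def leftTranslate (G : DefinableGroup L M) (g : G.carrier) (X : G.definableSubsets) :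
    G.definableSubsets :=
  ⟨(fun x => g * x) '' X.1, G.image_mul_left_mem g X.2⟩

/-- A Keisler measure on `G` over `M`: a finitely additive probability measure on the Boolean
algebra of all subsets of `G` definable in `M` with parameters. -/
structure KeislerMeasure (G : DefinableGroup L M) where
  /-- The measure of a definable subset. -/
  toFun : G.definableSubsets → ℝ
  nonneg : ∀ X, 0 ≤ toFun X
  map_top : toFun ⊤ = 1
  map_sup : ∀ X Y : G.definableSubsets, Disjoint (X : Set G.carrier) (Y : Set G.carrier) →
    toFun (X ⊔ Y) = toFun X + toFun Y

/-- `G` is *definably amenable* if there is a Keisler measure on `G` over `M` which is invariant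
under left translation by `G`. -/
def IsDefinablyAmenable (G : DefinableGroup L M) : Prop :=
  ∃ μ : G.KeislerMeasure, ∀ (g : G.carrier) (X : G.definableSubsets),
    μ.toFun (G.leftTranslate g X) = μ.toFun X

end DefinableGroup

/-!
Let `A` be a finite set of parameters over which `G` is defined. By smallness there are only
countably many types over `A`, so the Stone space of the Boolean algebra of `A`-definable subsets
of `G` is a countable compact space, on which the elements `g` of `G` such that `g` and `g⁻¹`
have coordinates in `A` act by homeomorphisms. A minimal nonempty closed invariant subset of it has
an isolated point by the Baire category theorem; removing all isolated points leaves a smaller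
closed invariant set, so every point is isolated and the minimal set is finite (`exists_finite_invariant_of_countable_compact`).
The uniform measure on these finitely many points of the Stone space is a finitely additive
probability measure on the `A`-definable sets, invariant under these elements
(`DefinableGroup.exists_mean_over_finite`).

Every definable set is definable over a finite set, so an ultralimit of these measures along the
directed set of all finite `A` is a measure on all definable sets, invariant under all of `G`.

The Stone space over `A` is realised concretely as a set of functions `Set G → Bool`, the image of
the space of ultrafilters on `G` under restriction to `A`-definable sets. Its countability is
obtained by sending an ultrafilter `p` to the type of the `p`-class of the identity in the
ultrapower of `M`, taken together with `A`.
-/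

open Filter Topology

/-! ### Countable compact dynamical systems -/

/-- A countable compact space acted upon by homeomorphisms has a finite invariant set: any minimal
nonempty closed invariant set will do. -/
theorem exists_finite_invariant_of_countable_compact {X : Type*} [TopologicalSpace X] [T2Space X]
    (H : Set (X ≃ₜ X)) {C : Set X} (hC : IsCompact C) (hne : C.Nonempty) (hcount : C.Countable)
    (hinv : ∀ h ∈ H, h '' C = C) :
    ∃ K ⊆ C, K.Finite ∧ K.Nonempty ∧ ∀ h ∈ H, h '' K = K := by
  obtain ⟨K, hKC, hK⟩ := zorn_superset_nonempty
    {K : Set X | K ⊆ C ∧ IsClosed K ∧ K.Nonempty ∧ ∀ h ∈ H, h '' K = K} (by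
      rintro c hc hchain ⟨K₀, hK₀⟩
      have : Nonempty c := ⟨⟨K₀, hK₀⟩⟩
      refine ⟨⋂₀ c, ⟨(sInter_subset_of_mem hK₀).trans (hc hK₀).1,
        isClosed_sInter fun K hK => (hc hK).2.1, ?_, fun h hh => ?_⟩,
        fun s hs => sInter_subset_of_mem hs⟩
      · exact IsCompact.nonempty_sInter_of_directed_nonempty_isCompact_isClosed
          (fun a ha b hb => (hchain.total ha hb).elim
            (fun h => ⟨a, ha, subset_rfl, h⟩) fun h => ⟨b, hb, h, subset_rfl⟩)
          (fun K hK => (hc hK).2.2.1)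
          (fun K hK => hC.of_isClosed_subset (hc hK).2.1 (hc hK).1)
          (fun K hK => (hc hK).2.1)
      · rw [sInter_eq_iInter, image_iInter h.bijective]
        exact iInter_congr fun K => (hc K.2).2.2.2 h hh)
    C ⟨subset_rfl, hC.isClosed, hne, hinv⟩
  obtain ⟨-, hKcl, hKne, hKinv⟩ := hK.prop
  have hKc : IsCompact K := hC.of_isClosed_subset hKcl hKC
  have : CompactSpace K := isCompact_iff_compactSpace.1 hKc
  have : Countable K := (hcount.mono hKC).to_subtype
  have : Nonempty K := hKne.to_subtype
  obtain ⟨x, hx⟩ := nonempty_interior_of_iUnion_of_closed (X := K) (f := fun x => {x})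
    (fun _ => isClosed_singleton) (by ext; simp)
  have hxo : IsOpen ({x} : Set K) := by
    have h := (subset_singleton_iff_eq.1 (interior_subset (s := ({x} : Set K)))).resolve_left
      hx.ne_empty
    rw [← h]
    exact isOpen_interior
  obtain ⟨V₀, hV₀, hV₀x⟩ := isOpen_induced_iff.1 hxo
  -- `W ∩ K` is the set of isolated points of `K`
  let W : Set (Set X) := {V | IsOpen V ∧ (V ∩ K).Subsingleton}
  have hV₀W : V₀ ∈ W := by
    refine ⟨hV₀, ?_⟩
    have h (y) (hy : y ∈ V₀ ∩ K) : y = x := by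
      have : (⟨y, hy.2⟩ : K) ∈ ({x} : Set K) := hV₀x ▸ hy.1
      exact congrArg Subtype.val this
    exact fun a ha b hb => (h a ha).trans (h b hb).symm
  have hWinv (h) (hh : h ∈ H) : h '' ⋃₀ W = ⋃₀ W := by
    have key (V : Set X) : h '' V ∈ W ↔ V ∈ W := by
      have e : h '' V ∩ K = h '' (V ∩ K) := by
        conv_lhs => rw [← hKinv h hh]
        rw [image_inter h.injective]
      change IsOpen (h '' V) ∧ (h '' V ∩ K).Subsingleton ↔ _
      rw [e, h.isOpen_image, h.injective.subsingleton_image_iff]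
      rfl
    ext y
    constructor
    · rintro ⟨z, ⟨V, hV, hz⟩, rfl⟩
      exact ⟨h '' V, (key V).2 hV, mem_image_of_mem h hz⟩
    · rintro ⟨V, hV, hy⟩
      refine ⟨h.symm y, ⟨h ⁻¹' V, (key _).1 ?_, by simpa using hy⟩, by simp⟩
      rwa [image_preimage_eq _ h.surjective]
  have hKW : K ⊆ ⋃₀ W := by
    by_contra hcon
    have hmin := hK.le_of_le (y := K \ ⋃₀ W)
      ⟨sdiff_subset.trans hKC, hKcl.sdiff (isOpen_sUnion fun V hV => hV.1),
        sdiff_nonempty.2 hcon, fun h hh => by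
          rw [image_sdiff h.injective, hKinv h hh, hWinv h hh]⟩ sdiff_subset
    have hxV : x ∈ Subtype.val ⁻¹' V₀ := hV₀x ▸ mem_singleton x
    exact (hmin x.2).2 ⟨V₀, hV₀W, hxV⟩
  obtain ⟨F, hFW, hF, hKF⟩ := hKc.elim_finite_subcover_image (b := W) (c := id) (fun V hV => hV.1)
    (by rwa [sUnion_eq_biUnion] at hKW)
  refine ⟨K, hKC, ?_, hKne, hKinv⟩
  refine (hF.biUnion fun V hV => (hFW hV).2.finite).subset fun y hy => ?_
  obtain ⟨V, hV, hyV⟩ := mem_iUnion₂.1 (hKF hy)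
  exact mem_biUnion hV ⟨hyV, hy⟩

/-! ### Types over finite sets -/

/-- Over a finite set `A` of parameters, a small theory has only countably many traces of
ultrafilters on the algebra of `A`-definable subsets of `D`. -/
theorem countable_range_ultrafilter_definable {L : FirstOrder.Language.{u, v}} {T : L.Theory}
    (hT : T.IsSmall) {M : Type w} [L.Structure M] [Nonempty M] (hM : M ⊨ T) {k : ℕ}
    (D : Set (Fin k → M)) {A : Set M} (hA : A.Finite) (hne : A.Nonempty) :
    (range fun p : Ultrafilter D =>
      {X : Set D | A.Definable L (Subtype.val '' X) ∧ X ∈ p}).Countable := by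
  classical
  have := hA.to_subtype
  have := hne.to_subtype
  -- `A` is nonempty, so `n ≥ 1` and smallness applies even when `k = 0`
  let n := Nat.card (A ⊕ Fin k)
  have hn : 1 ≤ n := Nat.card_pos
  let e : A ⊕ Fin k ≃ Fin n := Finite.equivFin _
  have := hT.countable_types n hn
  let x (i : Fin n) (d : D) : M := Sum.elim (Subtype.val : A → M) d.1 (e.symm i)
  have hmod (p : Ultrafilter D) : (p : Filter D).Product (fun _ => M) ⊨ T := by
    rw [Theory.model_iff]
    intro φ hφ
    rw [Ultraproduct.sentence_realize]
    exact Eventually.of_forall fun _ => hM.realize_of_mem φ hφ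
  have hnonempty (p : Ultrafilter D) : Nonempty ((p : Filter D).Product (fun _ => M)) :=
    Ultraproduct.Product.instNonempty
  -- `tp p` is the type of the `p`-class of the identity of `D`, together with an enumeration of `A`
  let tp (p : Ultrafilter D) : T.CompleteType (Fin n) :=
    T.typeOf (M := (p : Filter D).Product (fun _ => M)) fun i =>
      (x i : (p : Filter D).Product (fun _ => M))
  have htp (p : Ultrafilter D) (φ : L.Formula (Fin n)) :
      Formula.equivSentence φ ∈ tp p ↔ {d : D | φ.Realize fun i => x i d} ∈ p := by
    exact (Theory.CompleteType.formula_mem_typeOf (T := T)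
      (M := (p : Filter D).Product (fun _ => M))).trans (Ultraproduct.realize_formula_cast φ x)
  let Ψ (q : T.CompleteType (Fin n)) : Set (Set D) :=
    {X | A.Definable L (Subtype.val '' X) ∧ ∃ φ : L.Formula (Fin n),
      X = {d : D | φ.Realize fun i => x i d} ∧ Formula.equivSentence φ ∈ q}
  refine (countable_range Ψ).mono ?_
  rintro _ ⟨p, rfl⟩
  refine ⟨tp p, ?_⟩
  ext X
  have hcoord (φ : L.Formula (A ⊕ Fin k)) (d : D) :
      (φ.relabel e).Realize (fun i => x i d) ↔ φ.Realize (Sum.elim (Subtype.val : A → M) d.1) := by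
    rw [Formula.realize_relabel]
    have : (fun i => x i d) ∘ e = Sum.elim (Subtype.val : A → M) d.1 := by
      ext i
      simp [x]
    rw [this]
  constructor
  · rintro ⟨hX, φ, rfl, hφ⟩
    exact ⟨hX, (htp p φ).1 hφ⟩
  · rintro ⟨hX, hXp⟩
    obtain ⟨φ, hφ⟩ := definable_iff_exists_formula_sum.1 hX
    have hXφ : X = {d : D | (φ.relabel e).Realize fun i => x i d} := by
      ext d
      rw [mem_ofPred_eq, hcoord]
      have := congrArg (d.1 ∈ ·) hφ
      simpa [Subtype.val_injective.mem_set_image] using this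
    exact ⟨hX, φ.relabel e, hXφ, (htp p _).2 (hXφ ▸ hXp)⟩

/-! ### Definability over a set of parameters -/

namespace DefinableGroup

variable {L : FirstOrder.Language.{u, v}} {M : Type w} [L.Structure M]

/-- The subsets of `G` that are definable over `A`. -/
def definableOver (G : DefinableGroup L M) (A : Set M) : Set (Set G.carrier) :=
  {X | A.Definable L (Subtype.val '' X)}

/-- The graph of multiplication, as a subset of the sixfold concatenation of the ambient power. -/
def mulGraph (G : DefinableGroup L M) : Set (Fin G.dim ⊕ (Fin G.dim ⊕ Fin G.dim) → M) :=
  {v | ∃ g h : G.carrier, v = Sum.elim g.1 (Sum.elim h.1 (g * h).1)}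

theorem image_mul_left_mem_definableOver (G : DefinableGroup L M) {A : Set M}
    (hmul : A.Definable L G.mulGraph) {g : G.carrier} (hg : range g.1 ⊆ A) {X : Set G.carrier}
    (hX : X ∈ G.definableOver A) : (fun x => g * x) '' X ∈ G.definableOver A := by
  have hgdef : A.Definable L {v : Fin G.dim → M | v = g.1} := by
    have h (i : Fin G.dim) : A.Definable L {v : Fin G.dim → M | v i = g.1 i} :=
      ⟨(Term.var i).equal (L.con (⟨g.1 i, hg (mem_range_self i)⟩ : A)).term, by ext v; simp⟩
    convert definable_iInter_of_finite h using 1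
    ext v
    simp [funext_iff]
  have h1 := hgdef.preimage_comp (Sum.inl : Fin G.dim → Fin G.dim ⊕ (Fin G.dim ⊕ Fin G.dim))
  have h2 := Definable.preimage_comp
    (Sum.inr ∘ Sum.inl : Fin G.dim → Fin G.dim ⊕ (Fin G.dim ⊕ Fin G.dim)) hX
  have h3 := ((hmul.inter h1).inter h2).image_comp
    (Sum.inr ∘ Sum.inr : Fin G.dim → Fin G.dim ⊕ (Fin G.dim ⊕ Fin G.dim))
  change A.Definable L _
  convert h3 using 1
  ext w
  constructor
  · rintro ⟨_, ⟨x, hx, rfl⟩, rfl⟩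
    exact ⟨Sum.elim g.1 (Sum.elim x.1 (g * x).1), ⟨⟨⟨g, x, rfl⟩, rfl⟩, ⟨x, hx, rfl⟩⟩, rfl⟩
  · rintro ⟨_, ⟨⟨⟨a, b, rfl⟩, ha⟩, ⟨x, hx, hb⟩⟩, rfl⟩
    obtain rfl : a = g := Subtype.ext ha
    obtain rfl : x = b := Subtype.ext hb
    exact ⟨a * x, ⟨x, hx, rfl⟩, rfl⟩

/-- Inverting an element need not preserve membership of its coordinates in `A`, hence the
assumption on both `g` and `g⁻¹`. -/
theorem image_mul_left_mem_definableOver_iff (G : DefinableGroup L M) {A : Set M}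
    (hmul : A.Definable L G.mulGraph) {g : G.carrier} (hg : range g.1 ⊆ A)
    (hg' : range (g⁻¹).1 ⊆ A) {X : Set G.carrier} :
    (fun x => g * x) '' X ∈ G.definableOver A ↔ X ∈ G.definableOver A := by
  refine ⟨fun h => ?_, G.image_mul_left_mem_definableOver hmul hg⟩
  have := G.image_mul_left_mem_definableOver hmul hg' h
  rw [image_image] at this
  simpa only [inv_mul_cancel_left, image_id'] using this

/-! ### Invariant means -/

/-- Over a finite set `A` of parameters, `G` carries a mean on its `A`-definable subsets that is
invariant under the elements `g` such that `g` and `g⁻¹` have coordinates in `A`: the uniform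
measure on a finite invariant subset of the Stone space over `A`. -/
theorem exists_mean_over_finite {T : L.Theory} (hT : T.IsSmall) [Nonempty M] (hM : M ⊨ T)
    (G : DefinableGroup L M) {A : Set M} (hA : A.Finite) (hne : A.Nonempty)
    (hmul : A.Definable L G.mulGraph) :
    ∃ m : Set G.carrier → ℝ, (∀ X, m X ∈ Icc (0 : ℝ) 1) ∧
      (univ ∈ G.definableOver A → m univ = 1) ∧
      (∀ X ∈ G.definableOver A, ∀ Y ∈ G.definableOver A, Disjoint X Y →
        m (X ∪ Y) = m X + m Y) ∧
      ∀ g : G.carrier, range g.1 ⊆ A → range (g⁻¹).1 ⊆ A → ∀ X,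
        m ((fun x => g * x) '' X) = m X := by
  classical
  -- a point of the Stone space over `A` is encoded by its indicator function, extended by `false`
  let Φ (p : Ultrafilter G.carrier) (X : Set G.carrier) : Bool :=
    decide (X ∈ G.definableOver A ∧ X ∈ p)
  have hΦ : Continuous Φ := by
    refine continuous_pi fun X => ?_
    by_cases hX : X ∈ G.definableOver A
    · simp only [Φ, hX, true_and]
      exact (continuous_bool_rng true).2 (by
        have e : (fun p : Ultrafilter G.carrier => decide (X ∈ p)) ⁻¹' {true} = {p | X ∈ p} := by
          ext p; simp
        rw [e]
        exact ⟨ultrafilter_isClosed_basic X, ultrafilter_isOpen_basic X⟩)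
    · simp only [Φ, hX, false_and]
      exact continuous_const
  have hcount : (range Φ).Countable := by
    refine ((countable_range_ultrafilter_definable hT hM G.carrier hA hne).image
      fun S X => decide (X ∈ S)).mono ?_
    rintro _ ⟨p, rfl⟩
    exact ⟨_, ⟨p, rfl⟩, funext fun X => decide_eq_decide.2 Iff.rfl⟩
  -- translation by `g` on these indicator functions
  let τ (g : G.carrier) : (Set G.carrier → Bool) ≃ₜ (Set G.carrier → Bool) :=
    Homeomorph.piCongrLeft (Y := fun _ => Bool) (Equiv.Set.congr (Equiv.mulLeft g))
  have hτ (g : G.carrier) (f : Set G.carrier → Bool) (X : Set G.carrier) :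
      τ g f ((fun x => g * x) '' X) = f X :=
    Equiv.piCongrLeft_apply_apply (fun _ => Bool) (Equiv.Set.congr (Equiv.mulLeft g)) f X
  have hsurj (g : G.carrier) : Function.Surjective fun X : Set G.carrier => (fun x => g * x) '' X :=
    (Group.mulLeft_bijective g).surjective.image_surjective
  have hτΦ (g : G.carrier) (hg : range g.1 ⊆ A) (hg' : range (g⁻¹).1 ⊆ A)
      (p : Ultrafilter G.carrier) : τ g (Φ p) = Φ (p.map (g * ·)) := by
    ext Y
    obtain ⟨X, rfl⟩ := hsurj g Y
    simp only [hτ, Φ, G.image_mul_left_mem_definableOver_iff hmul hg hg', Ultrafilter.mem_map,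
      preimage_image_eq _ (mul_right_injective g)]
  obtain ⟨K, hKC, hKfin, hKne, hKinv⟩ := exists_finite_invariant_of_countable_compact
    (τ '' {g | range g.1 ⊆ A ∧ range (g⁻¹).1 ⊆ A}) (isCompact_range hΦ)
    ⟨_, mem_range_self (pure 1)⟩ hcount (by
      rintro _ ⟨g, ⟨hg, hg'⟩, rfl⟩
      have hg'' : range ((g⁻¹)⁻¹).1 ⊆ A := by rwa [inv_inv]
      ext f
      constructor
      · rintro ⟨_, ⟨p, rfl⟩, rfl⟩
        exact ⟨_, (hτΦ g hg hg' p).symm⟩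
      · rintro ⟨p, rfl⟩
        refine ⟨_, ⟨p.map (g⁻¹ * ·), rfl⟩, ?_⟩
        rw [hτΦ g hg hg', Ultrafilter.map_map]
        have e : ((g * ·) ∘ (g⁻¹ * ·) : G.carrier → G.carrier) = id := by ext; simp
        rw [e, Ultrafilter.map_id])
  have hKpos : (0 : ℝ) < K.ncard := by exact_mod_cast (ncard_pos hKfin).2 hKne
  refine ⟨fun X => (K ∩ {f | f X = true}).ncard / K.ncard, fun X => ⟨by positivity, ?_⟩,
    fun huniv => ?_, fun X hX Y hY hXY => ?_, fun g hg hg' X => ?_⟩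
  · rw [div_le_one hKpos]
    exact_mod_cast ncard_le_ncard inter_subset_left hKfin
  · have e : K ∩ {f | f univ = true} = K := by
      refine inter_eq_left.2 fun f hf => ?_
      obtain ⟨p, rfl⟩ := hKC hf
      exact decide_eq_true ⟨huniv, univ_mem⟩
    simp only [e]
    exact div_self hKpos.ne'
  · have hXY' : X ∪ Y ∈ G.definableOver A := by
      change A.Definable L _
      rw [image_union]
      exact Definable.union hX hY
    have e : K ∩ {f | f (X ∪ Y) = true} = (K ∩ {f | f X = true}) ∪ (K ∩ {f | f Y = true}) := by
      rw [← inter_union_distrib_left]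
      refine inter_congr_left ?_ ?_
      · rintro f ⟨hf, hf'⟩
        obtain ⟨p, rfl⟩ := hKC hf
        simpa [Φ, hX, hY, hXY'] using hf'
      · rintro f ⟨hf, hf'⟩
        obtain ⟨p, rfl⟩ := hKC hf
        simpa [Φ, hX, hY, hXY'] using hf'
    have hdisj : Disjoint (K ∩ {f | f X = true}) (K ∩ {f | f Y = true}) := by
      rw [disjoint_left]
      rintro f ⟨hf, hfX⟩ ⟨-, hfY⟩
      obtain ⟨p, rfl⟩ := hKC hf
      have h := inter_mem (of_decide_eq_true hfX).2 (of_decide_eq_true hfY).2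
      rw [hXY.inter_eq] at h
      exact p.empty_notMem h
    simp only [e]
    rw [ncard_union_eq hdisj (hKfin.inter_of_left _) (hKfin.inter_of_left _)]
    push_cast
    exact add_div _ _ _
  · have e : K ∩ {f | f ((fun x => g * x) '' X) = true} = τ g '' (K ∩ {f | f X = true}) := by
      conv_lhs => rw [← hKinv _ ⟨g, ⟨hg, hg'⟩, rfl⟩]
      ext f
      constructor
      · rintro ⟨⟨f, hf, rfl⟩, hf'⟩
        exact ⟨f, ⟨hf, by rwa [mem_ofPred_eq, hτ] at hf'⟩, rfl⟩
      · rintro ⟨f, ⟨hf, hf'⟩, rfl⟩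
        exact ⟨⟨f, hf, rfl⟩, by rwa [mem_ofPred_eq, hτ]⟩
    simp only [e, ncard_image_of_injective _ (τ g).injective]

end DefinableGroup

theorem corollary4p14 {L : FirstOrder.Language.{u, v}} (T : L.Theory) (hT : T.IsSmall)
    (M : Type w) [L.Structure M] [Nonempty M] (hM : M ⊨ T) (G : DefinableGroup L M) :
    G.IsDefinablyAmenable := by
  classical
  obtain ⟨A₀, -, hA₀⟩ := definable_iff_finitely_definable.1 G.definable_mul
  obtain ⟨a₀⟩ := ‹Nonempty M›
  have hmean (A : Finset M) : ∃ m : Set G.carrier → ℝ, insert a₀ A₀ ⊆ A →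
      (∀ X, m X ∈ Icc (0 : ℝ) 1) ∧
      (univ ∈ G.definableOver A → m univ = 1) ∧
      (∀ X ∈ G.definableOver A, ∀ Y ∈ G.definableOver A, Disjoint X Y →
        m (X ∪ Y) = m X + m Y) ∧
      ∀ g : G.carrier, range g.1 ⊆ A → range (g⁻¹).1 ⊆ A → ∀ X,
        m ((fun x => g * x) '' X) = m X := by
    by_cases hA : insert a₀ A₀ ⊆ A
    · rw [Finset.insert_subset_iff] at hA
      obtain ⟨m, hm⟩ := G.exists_mean_over_finite hT hM A.finite_toSet ⟨a₀, hA.1⟩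
        (hA₀.mono (Finset.coe_subset.2 hA.2))
      exact ⟨m, fun _ => hm⟩
    · exact ⟨0, fun h => absurd h hA⟩
  choose m hm using hmean
  -- an ultrafilter of finite parameter sets containing every cone `{A | B ⊆ A}`
  let 𝒰 : Ultrafilter (Finset M) := Ultrafilter.of atTop
  have h𝒰 {P : Finset M → Prop} (h : ∀ᶠ A in atTop, P A) : ∀ᶠ A in (𝒰 : Filter (Finset M)), P A :=
    Ultrafilter.of_le atTop h
  have hbase : ∀ᶠ A in atTop, insert a₀ A₀ ⊆ A := eventually_ge_atTop _
  have hdef (X : G.definableSubsets) : ∀ᶠ A : Finset M in atTop, X.1 ∈ G.definableOver A := by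
    obtain ⟨B, -, hB⟩ := definable_iff_finitely_definable.1
      (DefinableGroup.mem_definableSubsets.1 X.2)
    filter_upwards [eventually_ge_atTop B] with A hA
    exact Definable.mono hB (Finset.coe_subset.2 hA)
  have hrange (g : G.carrier) : ∀ᶠ A : Finset M in atTop, range g.1 ⊆ A := by
    filter_upwards [eventually_ge_atTop (Finset.univ.image g.1)] with A hA
    rintro _ ⟨i, rfl⟩
    exact hA (Finset.mem_image_of_mem _ (Finset.mem_univ i))
  have hlim (X : Set G.carrier) :
      ∃ r ∈ Icc (0 : ℝ) 1, Tendsto (fun A => m A X) 𝒰 (𝓝 r) := by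
    refine isCompact_Icc.ultrafilter_le_nhds (𝒰.map fun A => m A X) ?_
    rw [le_principal_iff]
    exact h𝒰 (hbase.mono fun A hA => (hm A hA).1 X)
  choose μ hμ hlim using hlim
  refine ⟨⟨fun X => μ X.1, fun X => (hμ X.1).1, ?_, fun X Y hXY => ?_⟩, fun g X => ?_⟩
  · refine tendsto_nhds_unique_of_eventuallyEq (hlim univ) tendsto_const_nhds (h𝒰 ?_)
    filter_upwards [hbase, hdef ⊤] with A hA hdef
    exact (hm A hA).2.1 hdef
  · refine tendsto_nhds_unique_of_eventuallyEq (hlim (X.1 ∪ Y.1))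
      ((hlim X.1).add (hlim Y.1)) (h𝒰 ?_)
    filter_upwards [hbase, hdef X, hdef Y] with A hA hX hY
    exact (hm A hA).2.2.1 X.1 hX Y.1 hY hXY
  · refine tendsto_nhds_unique_of_eventuallyEq (hlim _) (hlim X.1) (h𝒰 ?_)
    filter_upwards [hbase, hrange g, hrange g⁻¹] with A hA hg hg'
    exact (hm A hA).2.2.2 g hg hg' X.1
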